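/- Let $T>0$, $\sigma>0$, let $W$ be a standard Brownian motion on a probability space $(\Omega,P)$ and $B$ a standard Brownian motion on a (possibly different) probability space $(\Omega',P')$. For $a,b,c\in\mathbb R$ let $$X^{a,c}_t=a+ct+\sigma W_t,\qquad Y^{a,b}_t=a+\tfrac{b-a}{T}t+\sigma\bigl(B_t-\tfrac tT B_T\bigr),\qquad 0\le t\le T,$$ be the Brownian motion with drift $c$ started at $a$ and the driftless Brownian bridge from $a$ to $b$, both with volatility $\sigma$, regarded as random elements of $C([0,T],\mathbb R)$ with its Borel $\sigma$-algebra; for $a>0$ let $S^{a,c}_t=a\,e^{ct+\sigma W_t}$ be the geometric Brownian motion with exponential drift $c$ started at $a$. Write $\max x=\max_{0\le t\le T}x_t$. We say that $\nu$ is the conditional law of a random element $Z$ given $V=v$ (at the single point $v\in\mathbb R$, $V$ a real random variable) if $v$ lies in the support of the law of $V$ and the conditional laws of $Z$ given $V\in A$ converge weakly to $\nu$ as Borel sets $A$ with $P(V\in A)>0$ shrink to $v$; such a $\nu$ is unique. (1) Bridges. For every $a$ the laws of $Y^{a,b}$, $b\in\mathbb R$, form a Markov kernel which, for every $c\in\mathbb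 R$, is a regular conditional distribution of the path $X^{a,c}$ given $X^{a,c}_T$. Moreover, for all $a,b,c\in\mathbb R$, the conditional law of $X^{a,c}$ given $X^{a,c}_T=b$ is the law of $Y^{a,b}$. In particular it does not depend on the drift $c$. (2) Bridges with given maximum. For every $a$ there is a Markov kernel $\eta$ from $\mathbb R^2$ to $C([0,T],\mathbb R)$ such that, for every $b$, $\eta(b,\cdot)$ is a regular conditional distribution of the driftless bridge $Y^{a,b}$ given $\max Y^{a,b}$; and for every such $\eta$ and every $c$, $\eta$ is a regular conditional distribution of $X^{a,c}$ given $(X^{a,c}_T,\max X^{a,c})$. Moreover, let $a,b,c,M\in\mathbb R$ and let $\mu$ be the conditional law of $X^{a,c}$ given $X^{a,c}_T=b$ (the law of the bridge with drift). Then a probability measure $\nu$ is the conditional law under $\mu$ of the path given that its maximum is $M$ if and only if $\nu$ is the conditional law of $Y^{a,b}$ given $\max Y^{a,b}=M$. (3) Geometric bridges. For every $a>0$ there is a Markov kernel whose value at each $b>0$ is the law of $\exp(Y^{\ln a,\ln b})$ and which, for every $c$, is a regular conditional distribution of $S^{a,c}$ given $S^{a,c}_T$. Moreover, for all $a,b>0$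 and $c\in\mathbb R$, the conditional law of $S^{a,c}$ given $S^{a,c}_T=b$ is the law of $\exp(Y^{\ln a,\ln b})$. (4) Geometric bridges with given maximum. Let $a>0$ and let $\eta$ be as in (2) for the initial value $\ln a$. For every $c$, a regular conditional distribution of $S^{a,c}$ given $(S^{a,c}_T,\max S^{a,c})=(b,M)$ is the image of $\eta(\ln b,\ln M)$ under the pointwise exponential $x\mapsto e^{x}$. Moreover, let $a,b,M>0$, $c\in\mathbb R$, and let $\mu$ be the conditional law of $S^{a,c}$ given $S^{a,c}_T=b$; if $\nu$ is the conditional law of $Y^{\ln a,\ln b}$ given $\max Y^{\ln a,\ln b}=\ln M$, then the image of $\nu$ under the pointwise exponential is the conditional law under $\mu$ of the path given that its maximum is $M$. -/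

import Mathlib

open MeasureTheory ProbabilityTheory Filter Topology
open scoped NNReal ENNReal BoundedContinuousFunction

noncomputable section

namespace DriftBridge

/-- The path space `C([0,T], ℝ)`, with the topology of uniform convergence. -/
abbrev PathSpace (T : ℝ≥0) : Type := C(Set.Icc (0 : ℝ≥0) T, ℝ)

/-- The path space carries its Borel σ-algebra. -/
instance instMeasurableSpacePathSpace (T : ℝ≥0) : MeasurableSpace (PathSpace T) := borel _

instance instBorelSpacePathSpace (T : ℝ≥0) : BorelSpace (PathSpace T) := ⟨rfl⟩

/-- A function on `[0,T]` seen as a path. The value `0` at a discontinuous function only serves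
the null set on which the sample path of a Brownian motion is not continuous. -/
def toPath (T : ℝ≥0) (f : Set.Icc (0 : ℝ≥0) T → ℝ) : PathSpace T :=
  open Classical in if h : Continuous f then ⟨f, h⟩ else 0

/-- The terminal value `x(T)` of a path. -/
def endpoint {T : ℝ≥0} (x : PathSpace T) : ℝ := x ⟨T, Set.right_mem_Icc.2 bot_le⟩

/-- The maximum of a path over `[0,T]`. -/
def pathMax {T : ℝ≥0} (x : PathSpace T) : ℝ := ⨆ t, x t

/-- The pointwise exponential of a path. -/
def expPath {T : ℝ≥0} (x : PathSpace T) : PathSpace T :=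
  ⟨fun t ↦ Real.exp (x t), Real.continuous_exp.comp x.continuous⟩

/-- Brownian motion on `[0,T]` with initial value `a`, drift `c` and volatility `σ`, driven by
`W`: `X t = a + c t + σ W t`. -/
def driftedBM {Ω : Type*} (T : ℝ≥0) (W : ℝ≥0 → Ω → ℝ) (σ c a : ℝ) (ω : Ω) : PathSpace T :=
  toPath T fun t ↦ a + c * ((t : ℝ≥0) : ℝ) + σ * W t ω

/-- Geometric Brownian motion on `[0,T]` with initial value `a`, exponential drift `c` and
volatility `σ`, driven by `W`: `S t = a exp (c t + σ W t)`. -/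
def geometricBM {Ω : Type*} (T : ℝ≥0) (W : ℝ≥0 → Ω → ℝ) (σ c a : ℝ) (ω : Ω) : PathSpace T :=
  toPath T fun t ↦ a * Real.exp (c * ((t : ℝ≥0) : ℝ) + σ * W t ω)

/-- The driftless Brownian bridge on `[0,T]` from `a` to `b` with volatility `σ`, constructed
from `B`: `Y t = a + (b - a) / T * t + σ (B t - B T / T * t)`. -/
def bridge {Ω : Type*} (T : ℝ≥0) (B : ℝ≥0 → Ω → ℝ) (σ a b : ℝ) (ω : Ω) : PathSpace T :=
  toPath T fun t ↦ a + (b - a) / (T : ℝ) * ((t : ℝ≥0) : ℝ)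
    + σ * (B t ω - B T ω / (T : ℝ) * ((t : ℝ≥0) : ℝ))

/-- `ν` is the conditional law of `Z` given `Y = y`, at the single point `y` (which may have
probability zero): `y` is in the support of the law of `Y`, and the conditional laws of `Z` given
`Y ∈ A` converge weakly to `ν` as the Borel sets `A` with `P (Y ∈ A) ≠ 0` shrink to `y`
(conditional distribution in the sense of Tjur). There is at most one such `ν` on a metric
space with its Borel σ-algebra. -/
structure HasCondLawAt {Ω E : Type*} [MeasurableSpace Ω] [TopologicalSpace E] [MeasurableSpace E]
    (Z : Ω → E) (Y : Ω → ℝ) (P : Measure Ω) (y : ℝ) (ν : Measure E) : Prop where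
  aemeasurable_left : AEMeasurable Z P
  aemeasurable_right : AEMeasurable Y P
  isProbabilityMeasure : IsProbabilityMeasure ν
  mem_support : ∀ U ∈ 𝓝 y, P (Y ⁻¹' U) ≠ 0
  tendsto : ∀ f : E →ᵇ ℝ,
    Tendsto (fun A : Set ℝ ↦ ∫ ω, f (Z ω) ∂(P[|Y ⁻¹' A]))
      ((𝓝 y).smallSets ⊓ 𝓟 {A | MeasurableSet A ∧ P (Y ⁻¹' A) ≠ 0})
      (𝓝 (∫ z, f z ∂ν))

/-- `η` is a regular conditional law of the driftless bridges from `a`, given their maximum: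
for every `b`, `M ↦ η (b, M)` is a regular conditional distribution of the bridge from `a` to `b`
given its maximum. -/
def IsBridgeGivenMax {Ω : Type*} [MeasurableSpace Ω] (T : ℝ≥0) (B : ℝ≥0 → Ω → ℝ) (P : Measure Ω)
    (σ a : ℝ) (η : Kernel (ℝ × ℝ) (PathSpace T)) : Prop :=
  IsMarkovKernel η ∧
    ∀ b : ℝ, HasCondDistrib (bridge T B σ a b) (fun ω ↦ pathMax (bridge T B σ a b ω))
      (η.sectR b) P

end DriftBridge

end

noncomputable section

namespace DriftBridge

section CondLaw

variable {Ω E F : Type*} [MeasurableSpace Ω] {P : Measure Ω}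

lemma hasCondDistrib_congr {α β : Type*} [MeasurableSpace α] [MeasurableSpace β]
    {X X' : Ω → α} {Y Y' : Ω → β} {κ : Kernel β α} (h : HasCondDistrib X Y κ P)
    (hX : X' =ᵐ[P] X) (hY : Y' =ᵐ[P] Y) : HasCondDistrib X' Y' κ P := by
  unfold HasCondDistrib
  rw [Measure.map_congr hY]
  refine HasLaw.congr h ?_
  filter_upwards [hX, hY] with ω h₁ h₂
  rw [h₁, h₂]

/-- The kernel `v ↦ law of F (v, Z)`, for `Z` with law `ρ`. -/
def freezeKernel {α β γ : Type*} [MeasurableSpace α] [MeasurableSpace β] [MeasurableSpace γ]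
    (ρ : Measure β) [SFinite ρ] (F : α × β → γ) (hF : Measurable F) : Kernel α γ where
  toFun v := ρ.map fun z ↦ F (v, z)
  measurable' := by
    refine Measure.measurable_of_measurable_coe _ fun s hs ↦ ?_
    have hF' (v : α) : Measurable fun z ↦ F (v, z) := hF.comp measurable_prodMk_left
    simp_rw [Measure.map_apply (hF' _) hs]
    exact measurable_measure_prodMk_left (hF hs)

lemma freezeKernel_apply {α β γ : Type*} [MeasurableSpace α] [MeasurableSpace β]
    [MeasurableSpace γ] (ρ : Measure β) [SFinite ρ] (F : α × β → γ) (hF : Measurable F) (v : α) :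
    freezeKernel ρ F hF v = ρ.map fun z ↦ F (v, z) := rfl

instance {α β γ : Type*} [MeasurableSpace α] [MeasurableSpace β] [MeasurableSpace γ]
    (ρ : Measure β) [IsProbabilityMeasure ρ] (F : α × β → γ) (hF : Measurable F) :
    IsMarkovKernel (freezeKernel ρ F hF) :=
  ⟨fun _ ↦ Measure.isProbabilityMeasure_map (hF.comp measurable_prodMk_left).aemeasurable⟩

/-- The conditional distribution of `F (V, Z)` given `V`, when `Z` is independent of `V`, is
obtained by freezing the value of `V`. -/
lemma IndepFun.hasCondDistrib_freezeKernel [IsProbabilityMeasure P]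
    {α β γ : Type*} [MeasurableSpace α] [MeasurableSpace β] [MeasurableSpace γ]
    {V : Ω → α} {Z : Ω → β} {ρ : Measure β} [IsProbabilityMeasure ρ] {F : α × β → γ}
    (h : IndepFun V Z P) (hV : AEMeasurable V P) (hZ : HasLaw Z ρ P) (hF : Measurable F) :
    HasCondDistrib (fun ω ↦ F (V ω, Z ω)) V (freezeKernel ρ F hF) P := by
  have hVZ := hV.prodMk hZ.aemeasurable
  refine ⟨hV.prodMk (hF.comp_aemeasurable hVZ), ?_⟩
  have : IsProbabilityMeasure (P.map V) := Measure.isProbabilityMeasure_map hV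
  have hmeas : Measurable fun p : α × β ↦ (p.1, F p) := measurable_fst.prodMk hF
  have key : P.map (fun ω ↦ (V ω, F (V ω, Z ω)))
      = ((P.map V).prod ρ).map fun p ↦ (p.1, F p) := by
    rw [← hZ.map_eq, ← (indepFun_iff_map_prod_eq_prod_map_map hV hZ.aemeasurable).1 h,
      AEMeasurable.map_map_of_aemeasurable hmeas.aemeasurable hVZ]
    rfl
  ext s hs
  rw [key, Measure.map_apply hmeas hs, Measure.prod_apply (hmeas hs), Measure.compProd_apply hs]
  refine lintegral_congr fun v ↦ ?_
  have hF' : Measurable fun z ↦ F (v, z) := hF.comp measurable_prodMk_left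
  rw [freezeKernel_apply, Measure.map_apply hF' (measurable_prodMk_left hs)]
  rfl

variable [TopologicalSpace E] [MeasurableSpace E]

lemma HasCondLawAt.congr {Z Z' : Ω → E} {Y Y' : Ω → ℝ} {y : ℝ} {ν : Measure E}
    (h : HasCondLawAt Z Y P y ν) (hZ : Z' =ᵐ[P] Z) (hY : Y' =ᵐ[P] Y) :
    HasCondLawAt Z' Y' P y ν := by
  have hset (A : Set ℝ) : Y' ⁻¹' A =ᵐ[P] Y ⁻¹' A := by
    filter_upwards [hY] with ω hω
    exact congrArg (· ∈ A) hω
  have hcond (A : Set ℝ) : P[|Y' ⁻¹' A] = P[|Y ⁻¹' A] := by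
    rw [ProbabilityTheory.cond, ProbabilityTheory.cond, measure_congr (hset A),
      Measure.restrict_congr_set (hset A)]
  refine ⟨h.1.congr hZ.symm, h.2.congr hY.symm, h.3, fun U hU ↦ ?_, fun f ↦ ?_⟩
  · rw [measure_congr (hset U)]
    exact h.mem_support U hU
  · simp_rw [measure_congr (hset _), hcond]
    refine (h.tendsto f).congr fun A ↦ integral_congr_ae ?_
    filter_upwards [cond_absolutelyContinuous.ae_le hZ] with ω hω
    rw [hω]

/-- The filter along which the conditional laws converge is not trivial. -/
lemma HasCondLawAt.neBot {Z : Ω → E} {Y : Ω → ℝ} {y : ℝ} {ν : Measure E}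
    (h : HasCondLawAt Z Y P y ν) :
    NeBot ((𝓝 y).smallSets ⊓ 𝓟 {A | MeasurableSet A ∧ P (Y ⁻¹' A) ≠ 0}) := by
  rw [inf_principal_neBot_iff]
  intro S hS
  obtain ⟨U, hU, hUS⟩ := eventually_smallSets.1 hS
  obtain ⟨V, hVU, hVo, hyV⟩ := mem_nhds_iff.1 hU
  exact ⟨V, hUS V hVU, hVo.measurableSet, h.mem_support V (hVo.mem_nhds hyV)⟩

lemma HasCondLawAt.unique [HasOuterApproxClosed E] [BorelSpace E] {Z : Ω → E} {Y : Ω → ℝ} {y : ℝ}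
    {ν ν' : Measure E} (h : HasCondLawAt Z Y P y ν) (h' : HasCondLawAt Z Y P y ν') : ν = ν' := by
  have := h.isProbabilityMeasure
  have := h'.isProbabilityMeasure
  have := h.neBot
  exact ext_of_forall_integral_eq_of_IsFiniteMeasure fun f ↦
    tendsto_nhds_unique (h.tendsto f) (h'.tendsto f)

/-- Conditional laws at a point under an image measure. -/
lemma hasCondLawAt_id_map_iff [BorelSpace E] [IsProbabilityMeasure P] {X : Ω → E}
    (hX : AEMeasurable X P) {g : E → ℝ} (hg : Measurable g) {y : ℝ} {ν : Measure E} :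
    HasCondLawAt id g (P.map X) y ν ↔ HasCondLawAt X (fun ω ↦ g (X ω)) P y ν := by
  have hmap {A : Set ℝ} (hA : MeasurableSet A) :
      P.map X (g ⁻¹' A) = P ((fun ω ↦ g (X ω)) ⁻¹' A) :=
    Measure.map_apply_of_aemeasurable hX (hg hA)
  have hset : {A : Set ℝ | MeasurableSet A ∧ P.map X (g ⁻¹' A) ≠ 0}
      = {A | MeasurableSet A ∧ P ((fun ω ↦ g (X ω)) ⁻¹' A) ≠ 0} := by
    ext A
    exact and_congr_right fun hA ↦ by rw [hmap hA]
  have hsupp : (∀ U ∈ 𝓝 y, P.map X (g ⁻¹' U) ≠ 0)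
      ↔ ∀ U ∈ 𝓝 y, P ((fun ω ↦ g (X ω)) ⁻¹' U) ≠ 0 := by
    constructor
    all_goals
      intro h U hU
      obtain ⟨V, hVU, hVo, hyV⟩ := mem_nhds_iff.1 hU
      have hV := h V (hVo.mem_nhds hyV)
      have hm := hmap hVo.measurableSet
    · exact fun h0 ↦ hV (hm.trans (measure_mono_null (Set.preimage_mono hVU) h0))
    · exact fun h0 ↦ hV (hm.symm.trans (measure_mono_null (Set.preimage_mono hVU) h0))
  have hint (f : E →ᵇ ℝ) : (fun A : Set ℝ ↦ ∫ x, f (id x) ∂((P.map X)[|g ⁻¹' A]))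
      =ᶠ[(𝓝 y).smallSets ⊓ 𝓟 {A | MeasurableSet A ∧ P ((fun ω ↦ g (X ω)) ⁻¹' A) ≠ 0}]
      fun A ↦ ∫ ω, f (X ω) ∂(P[|(fun ω ↦ g (X ω)) ⁻¹' A]) := by
    refine Filter.Eventually.filter_mono inf_le_right (eventually_principal.2 fun A hA ↦ ?_)
    simp only [ProbabilityTheory.cond, id_eq]
    rw [integral_smul_measure,
      integral_smul_measure, hmap hA.1, setIntegral_map (hg hA.1)
      f.continuous.measurable.aestronglyMeasurable hX]
    rfl
  constructor
  · intro h
    refine ⟨hX, hg.comp_aemeasurable hX, h.3, hsupp.1 h.4, fun f ↦ ?_⟩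
    have := h.tendsto f
    rw [hset] at this
    exact this.congr' (hint f)
  · intro h
    refine ⟨aemeasurable_id, hg.aemeasurable, h.3, hsupp.2 h.4, fun f ↦ ?_⟩
    rw [hset]
    exact (h.tendsto f).congr' (hint f).symm

/-- Conditional laws at a point under a topological embedding of the conditioning variable and a
continuous map of the conditioned one. -/
lemma HasCondLawAt.map [OpensMeasurableSpace E] [TopologicalSpace F] [MeasurableSpace F]
    [BorelSpace F] {Z : Ω → E} {Y : Ω → ℝ} {y : ℝ} {ν : Measure E}
    (h : HasCondLawAt Z Y P y ν) {g : E → F} (hg : Continuous g) {φ : ℝ → ℝ}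
    (hφ : IsEmbedding φ) :
    HasCondLawAt (fun ω ↦ g (Z ω)) (fun ω ↦ φ (Y ω)) P (φ y) (ν.map g) := by
  have := h.isProbabilityMeasure
  refine ⟨hg.measurable.comp_aemeasurable h.1, hφ.continuous.measurable.comp_aemeasurable h.2,
    Measure.isProbabilityMeasure_map hg.measurable.aemeasurable, fun U hU ↦ ?_, fun f ↦ ?_⟩
  · exact h.mem_support _ (hφ.continuous.continuousAt.preimage_mem_nhds hU)
  · rw [integral_map hg.measurable.aemeasurable f.continuous.measurable.aestronglyMeasurable]
    have ht : Tendsto (fun A : Set ℝ ↦ φ ⁻¹' A)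
        ((𝓝 (φ y)).smallSets ⊓ 𝓟 {A | MeasurableSet A ∧ P ((fun ω ↦ φ (Y ω)) ⁻¹' A) ≠ 0})
        ((𝓝 y).smallSets ⊓ 𝓟 {A | MeasurableSet A ∧ P (Y ⁻¹' A) ≠ 0}) := by
      refine tendsto_inf.2 ⟨?_, ?_⟩
      · refine Tendsto.mono_left (tendsto_smallSets_iff.2 fun U hU ↦ ?_) inf_le_left
        rw [hφ.nhds_eq_comap] at hU
        obtain ⟨V, hV, hVU⟩ := hU
        filter_upwards [eventually_smallSets_subset.2 hV] with A hA
        exact (Set.preimage_mono hA).trans hVU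
      · refine tendsto_principal.2 ?_
        filter_upwards [mem_inf_of_right (mem_principal_self _)] with A hA
        exact ⟨hφ.continuous.measurable hA.1, hA.2⟩
    have := (h.tendsto (f.compContinuous ⟨g, hg⟩)).comp ht
    simpa only [Function.comp_def, BoundedContinuousFunction.compContinuous_apply,
      ContinuousMap.coe_mk, Set.preimage_preimage] using this

/-- A regular conditional distribution that is weakly continuous at a point of the support gives
the conditional law at that point. -/
lemma HasCondLawAt.of_hasCondDistrib [OpensMeasurableSpace E] [IsProbabilityMeasure P]
    {Z : Ω → E} {Y : Ω → ℝ} {κ : Kernel ℝ E} [IsMarkovKernel κ] {y : ℝ}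
    (h : HasCondDistrib Z Y κ P) (hsupp : ∀ U ∈ 𝓝 y, P (Y ⁻¹' U) ≠ 0)
    (hκ : ∀ f : E →ᵇ ℝ, ContinuousAt (fun v ↦ ∫ x, f x ∂(κ v)) y) :
    HasCondLawAt Z Y P y (κ y) := by
  have hY : AEMeasurable Y P := h.aemeasurable_fst
  have hZ : AEMeasurable Z P := h.aemeasurable_snd
  have : IsProbabilityMeasure (P.map Y) := Measure.isProbabilityMeasure_map hY
  refine ⟨hZ, hY, inferInstance, hsupp, fun f ↦ ?_⟩
  set g : ℝ → ℝ := fun v ↦ ∫ x, f x ∂(κ v)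
  have hf : Integrable (fun p : ℝ × E ↦ f p.2) (P.map Y ⊗ₘ κ) := by
    refine Integrable.of_bound
      (f.continuous.measurable.comp measurable_snd).aestronglyMeasurable ‖f‖ ?_
    exact ae_of_all _ fun p ↦ f.norm_coe_le_norm p.2
  have hgi : Integrable g (P.map Y) := hf.integral_compProd
  have key {A : Set ℝ} (hA : MeasurableSet A) :
      ∫ ω, f (Z ω) ∂(P[|Y ⁻¹' A]) = ∫ v, g v ∂((P.map Y)[|A]) := by
    rw [ProbabilityTheory.cond, ProbabilityTheory.cond, integral_smul_measure,
      integral_smul_measure, Measure.map_apply_of_aemeasurable hY hA]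
    congr 1
    have h1 := setIntegral_map (hA.prod MeasurableSet.univ)
      (f := fun p : ℝ × E ↦ f p.2) (μ := P)
      (f.continuous.measurable.comp measurable_snd).aestronglyMeasurable (hY.prodMk hZ)
    have h2 : (fun ω ↦ (Y ω, Z ω)) ⁻¹' (A ×ˢ Set.univ) = Y ⁻¹' A := by
      ext; simp
    rw [h2] at h1
    rw [← h1, h.map_eq, Measure.setIntegral_compProd hA MeasurableSet.univ hf.integrableOn]
    simp [g]
  rw [Metric.tendsto_nhds]
  intro ε hε
  have hU : {v | dist (g v) (g y) ≤ ε / 2} ∈ 𝓝 y := by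
    filter_upwards [Metric.continuousAt_iff'.1 (hκ f) (ε / 2) (by positivity)] with v hv
    exact hv.le
  filter_upwards [Filter.Eventually.filter_mono inf_le_left (eventually_smallSets_subset.2 hU),
    Filter.Eventually.filter_mono inf_le_right (eventually_principal.2 fun A hA ↦ hA)] with A hAU hA
  have hA0 : P.map Y A ≠ 0 := by
    rw [Measure.map_apply_of_aemeasurable hY hA.1]
    exact hA.2
  have : IsProbabilityMeasure ((P.map Y)[|A]) := cond_isProbabilityMeasure hA0
  have hgA : Integrable g ((P.map Y)[|A]) :=
    hgi.integrableOn.smul_measure (ENNReal.inv_ne_top.2 hA0)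
  rw [key hA.1, dist_eq_norm]
  have hsub : ∫ v, g v ∂((P.map Y)[|A]) - ∫ x, f x ∂(κ y)
      = ∫ v, (g v - g y) ∂((P.map Y)[|A]) := by
    rw [integral_sub hgA (integrable_const _)]
    simp [g]
  rw [hsub]
  have hb : ∀ᵐ v ∂((P.map Y)[|A]), ‖g v - g y‖ ≤ ε / 2 :=
    ae_cond_of_forall_mem hA.1 fun v hv ↦ by
      have := hAU hv
      rwa [Set.mem_ofPred_eq, dist_eq_norm] at this
  have := norm_integral_le_of_norm_le_const hb
  simp only [probReal_univ, mul_one] at this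
  linarith

end CondLaw

section Paths

variable {T : ℝ≥0}

lemma toPath_apply {f : Set.Icc (0 : ℝ≥0) T → ℝ} (hf : Continuous f) (t : Set.Icc (0 : ℝ≥0) T) :
    toPath T f t = f t := by
  simp [toPath, hf]

instance : Nonempty (Set.Icc (0 : ℝ≥0) T) := ⟨⟨0, by simp⟩⟩

/-- The restriction of a path to a dense sequence of times. -/
def sampledPath (x : PathSpace T) (n : ℕ) : ℝ := x (TopologicalSpace.denseSeq _ n)

lemma measurableEmbedding_sampledPath :
    MeasurableEmbedding (sampledPath : PathSpace T → ℕ → ℝ) := by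
  refine Continuous.measurableEmbedding ?_ fun x y hxy ↦ ?_
  · exact continuous_pi fun n ↦ continuous_eval_const _
  · refine DFunLike.coe_injective ?_
    exact (TopologicalSpace.denseRange_denseSeq _).equalizer x.continuous y.continuous hxy

variable {Ω : Type*} [MeasurableSpace Ω] {P : Measure Ω}

lemma sampledPath_toPath_ae_eq {f : Ω → Set.Icc (0 : ℝ≥0) T → ℝ}
    (hc : ∀ᵐ ω ∂P, Continuous (f ω)) :
    (fun ω ↦ sampledPath (toPath T (f ω)))
      =ᵐ[P] fun ω n ↦ f ω (TopologicalSpace.denseSeq _ n) := by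
  filter_upwards [hc] with ω hω
  funext n
  exact toPath_apply hω _

lemma aemeasurable_toPath {f : Ω → Set.Icc (0 : ℝ≥0) T → ℝ}
    (hm : ∀ t, AEMeasurable (fun ω ↦ f ω t) P) (hc : ∀ᵐ ω ∂P, Continuous (f ω)) :
    AEMeasurable (fun ω ↦ toPath T (f ω)) P := by
  rw [← measurableEmbedding_sampledPath.aemeasurable_comp_iff]
  exact (aemeasurable_pi_lambda _ fun n ↦ hm _).congr (sampledPath_toPath_ae_eq hc).symm

lemma bddAbove_range_path (x : PathSpace T) : BddAbove (Set.range x) :=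
  (isCompact_range x.continuous).bddAbove

lemma continuous_pathMax : Continuous (pathMax : PathSpace T → ℝ) := by
  refine (LipschitzWith.of_le_add fun x y ↦ ?_ : LipschitzWith 1 _).continuous
  refine ciSup_le fun t ↦ ?_
  have h₁ := le_ciSup (bddAbove_range_path y) t
  have h₂ := (abs_le.1 ((Real.dist_eq _ _).symm.trans_le (ContinuousMap.dist_apply_le_dist (f := x)
    (g := y) t))).2
  simp only [pathMax]
  linarith

lemma continuous_expPath : Continuous (expPath : PathSpace T → PathSpace T) :=
  ContinuousMap.continuous_postcomp ⟨Real.exp, Real.continuous_exp⟩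

lemma endpoint_expPath (x : PathSpace T) : endpoint (expPath x) = Real.exp (endpoint x) := rfl

lemma pathMax_expPath (x : PathSpace T) : pathMax (expPath x) = Real.exp (pathMax x) :=
  (Real.exp_monotone.map_ciSup_of_continuousAt Real.continuous_exp.continuousAt
    (bddAbove_range_path x)).symm

end Paths

section Bridge

variable {Ω Ω' : Type*} [MeasurableSpace Ω] [MeasurableSpace Ω'] {P : Measure Ω} {P' : Measure Ω'}
  {T : ℝ≥0} {W : ℝ≥0 → Ω → ℝ} {B : ℝ≥0 → Ω' → ℝ}

/-- The standard bridge `t ↦ B t - B T / T * t` from `0` to `0`. -/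
def standardBridge (T : ℝ≥0) (B : ℝ≥0 → Ω → ℝ) (ω : Ω) : PathSpace T :=
  toPath T fun t ↦ B t ω - B T ω / (T : ℝ) * ((t : ℝ≥0) : ℝ)

lemma continuous_standardBridge_fun {Ω : Type*} {W : ℝ≥0 → Ω → ℝ} {ω : Ω} (h : Continuous (W · ω)) :
    Continuous fun t : Set.Icc (0 : ℝ≥0) T ↦ W t ω - W T ω / (T : ℝ) * ((t : ℝ≥0) : ℝ) := by
  fun_prop

/-- The path `t ↦ a + (b - a) / T * t + σ z t`. -/
def bridgeOf (T : ℝ≥0) (σ a : ℝ) (p : ℝ × PathSpace T) : PathSpace T :=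
  ⟨fun t ↦ a + (p.1 - a) / (T : ℝ) * ((t : ℝ≥0) : ℝ) + σ * p.2 t, by fun_prop⟩

lemma continuous_bridgeOf (T : ℝ≥0) (σ a : ℝ) : Continuous (bridgeOf T σ a) := by
  refine ContinuousMap.continuous_of_continuous_uncurry _ ?_
  have : Continuous fun q : (ℝ × PathSpace T) × Set.Icc (0 : ℝ≥0) T ↦ q.1.2 q.2 := by fun_prop
  change Continuous fun q : (ℝ × PathSpace T) × Set.Icc (0 : ℝ≥0) T ↦
    a + (q.1.1 - a) / (T : ℝ) * ((q.2 : ℝ≥0) : ℝ) + σ * q.1.2 q.2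
  fun_prop

lemma bridge_ae_eq (hB : IsBrownianReal B P') (σ a b : ℝ) :
    bridge T B σ a b =ᵐ[P'] fun ω ↦ bridgeOf T σ a (b, standardBridge T B ω) := by
  filter_upwards [hB.cont] with ω hω
  ext t
  rw [bridge, toPath_apply (by fun_prop)]
  simp only [bridgeOf, ContinuousMap.coe_mk, standardBridge]
  rw [toPath_apply (continuous_standardBridge_fun hω)]

lemma endpoint_driftedBM_ae_eq (hW : IsBrownianReal W P) (σ c a : ℝ) :
    (fun ω ↦ endpoint (driftedBM T W σ c a ω)) =ᵐ[P] fun ω ↦ a + c * (T : ℝ) + σ * W T ω := by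
  filter_upwards [hW.cont] with ω hω
  rw [endpoint, driftedBM, toPath_apply (by fun_prop)]

lemma driftedBM_ae_eq (hW : IsBrownianReal W P) (hT : 0 < T) (σ c a : ℝ) :
    driftedBM T W σ c a =ᵐ[P]
      fun ω ↦ bridgeOf T σ a (a + c * (T : ℝ) + σ * W T ω, standardBridge T W ω) := by
  have hT' : (T : ℝ) ≠ 0 := by exact_mod_cast hT.ne'
  filter_upwards [hW.cont] with ω hω
  ext t
  rw [driftedBM, toPath_apply (by fun_prop)]
  simp only [bridgeOf, ContinuousMap.coe_mk, standardBridge]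
  rw [toPath_apply (continuous_standardBridge_fun hω)]
  field_simp
  ring

lemma geometricBM_ae_eq (hW : IsBrownianReal W P) (σ c : ℝ) {a : ℝ} (ha : 0 < a) :
    geometricBM T W σ c a =ᵐ[P] fun ω ↦ expPath (driftedBM T W σ c (Real.log a) ω) := by
  filter_upwards [hW.cont] with ω hω
  ext t
  rw [geometricBM, toPath_apply (by fun_prop)]
  simp only [expPath, ContinuousMap.coe_mk, driftedBM]
  rw [toPath_apply (by fun_prop), add_assoc, Real.exp_add (Real.log a), Real.exp_log ha]

lemma aemeasurable_standardBridge (hW : IsBrownianReal W P) :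
    AEMeasurable (standardBridge T W) P := by
  refine aemeasurable_toPath (fun t ↦ ?_) ?_
  · exact (hW.aemeasurable _).sub (((hW.aemeasurable _).div_const _).mul_const _)
  · filter_upwards [hW.cont] with ω hω using continuous_standardBridge_fun hω

/-- Two Brownian motions have the same law along a countable family of times. -/
lemma map_comp_eq_of_isPreBrownianReal (hW : IsPreBrownianReal W P) (hB : IsPreBrownianReal B P')
    {ι : Type*} [Countable ι] (u : ι → ℝ≥0) :
    P.map (fun ω i ↦ W (u i) ω) = P'.map fun ω i ↦ B (u i) ω := by
  classical
  have := hW.isGaussianProcess.isProbabilityMeasure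
  have := hB.isGaussianProcess.isProbabilityMeasure
  have hWm : AEMeasurable (fun ω i ↦ W (u i) ω) P :=
    aemeasurable_pi_lambda _ fun i ↦ hW.aemeasurable _
  have hBm : AEMeasurable (fun ω i ↦ B (u i) ω) P' :=
    aemeasurable_pi_lambda _ fun i ↦ hB.aemeasurable _
  have hlaw (I : Finset ι) : P.map (fun ω ↦ I.restrict fun i ↦ W (u i) ω)
      = P'.map fun ω ↦ I.restrict fun i ↦ B (u i) ω := by
    let r : (↥(Finset.image u I : Finset ℝ≥0) → ℝ) → I → ℝ :=
      fun x i ↦ x ⟨u i, Finset.mem_image_of_mem u i.2⟩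
    have hr : Measurable r := by fun_prop
    have h1 := (MeasurePreserving.mk hr rfl).hasLaw.comp (hW.hasLaw (I.image u))
    have h2 := (MeasurePreserving.mk hr rfl).hasLaw.comp (hB.hasLaw (I.image u))
    exact h1.map_eq.trans h2.map_eq.symm
  have h1 := isProjectiveLimit_map hWm
  have h2 := isProjectiveLimit_map hBm
  simp_rw [hlaw] at h1
  have (I : Finset ι) : IsFiniteMeasure (P'.map fun ω ↦ I.restrict fun i ↦ B (u i) ω) :=
    inferInstance
  exact h1.unique h2

/-- The sampled standard bridge as a function of countably many values of the Brownian motion. -/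
lemma map_sampledPath_standardBridge (hW : IsBrownianReal W P) :
    (P.map (standardBridge T W)).map sampledPath
      = (P.map fun ω (i : Option ℕ) ↦ W (i.elim T fun n ↦ TopologicalSpace.denseSeq
          (Set.Icc (0 : ℝ≥0) T) n) ω).map fun x n ↦ x (some n) - x none / (T : ℝ) *
            ((TopologicalSpace.denseSeq (Set.Icc (0 : ℝ≥0) T) n : ℝ≥0) : ℝ) := by
  rw [AEMeasurable.map_map_of_aemeasurable
    measurableEmbedding_sampledPath.measurable.aemeasurable (aemeasurable_standardBridge hW),
    AEMeasurable.map_map_of_aemeasurable (Measurable.aemeasurable (by fun_prop))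
    (aemeasurable_pi_lambda _ fun i ↦ hW.aemeasurable _)]
  refine Measure.map_congr (sampledPath_toPath_ae_eq ?_)
  filter_upwards [hW.cont] with ω hω using continuous_standardBridge_fun hω

lemma map_standardBridge_eq (hW : IsBrownianReal W P) (hB : IsBrownianReal B P') :
    P.map (standardBridge T W) = P'.map (standardBridge T B) := by
  rw [← measurableEmbedding_sampledPath.comap_map (P.map (standardBridge T W)),
    map_sampledPath_standardBridge hW, map_comp_eq_of_isPreBrownianReal hW.1 hB.1,
    ← map_sampledPath_standardBridge hB, measurableEmbedding_sampledPath.comap_map]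

/-- The standard bridge is independent of the terminal value of the Brownian motion. -/
lemma indepFun_standardBridge (hW : IsBrownianReal W P) (hT : 0 < T) :
    IndepFun (W T) (standardBridge T W) P := by
  have hT' : (T : ℝ) ≠ 0 := by exact_mod_cast hT.ne'
  have := hW.isGaussianProcess.isProbabilityMeasure
  let X : Unit → Ω → ℝ := fun _ ↦ W T
  let Z : Set.Icc (0 : ℝ≥0) T → Ω → ℝ :=
    fun t ω ↦ W t ω - ((t : ℝ≥0) : ℝ) / (T : ℝ) * W T ω
  have hL2 (t : ℝ≥0) : MemLp (W t) 2 P := (hW.isGaussianProcess.hasGaussianLaw_eval t).memLp_two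
  have hXZ : IsGaussianProcess (Sum.elim X Z) P := by
    refine hW.isGaussianProcess.of_isGaussianProcess ?_
    rintro (_ | t)
    · exact ⟨{T}, .proj ⟨T, by simp⟩, fun ω ↦ rfl⟩
    · exact ⟨{(t : ℝ≥0), T},
        ContinuousLinearMap.proj (R := ℝ) (φ := fun _ ↦ ℝ) ⟨(t : ℝ≥0), by simp⟩
        - (((t : ℝ≥0) : ℝ) / (T : ℝ)) •
          ContinuousLinearMap.proj (R := ℝ) (φ := fun _ ↦ ℝ) ⟨T, by simp⟩, fun ω ↦ rfl⟩
  have hcov : ∀ s t, cov[X s, Z t; P] = 0 := by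
    intro s t
    rw [covariance_fun_sub_right (hL2 _) (hL2 _) ((hL2 _).const_mul _),
      covariance_const_mul_right]
    have h1 := hW.covariance_eval T t
    have h2 := hW.covariance_eval T T
    rw [min_eq_right t.2.2] at h1
    rw [min_self] at h2
    change cov[W T, W t; P] - _ * cov[W T, W T; P] = 0
    rw [h1, h2]
    field_simp
    ring
  have hind := hXZ.indepFun_of_covariance_eq_zero (fun _ ↦ hW.aemeasurable T)
    (fun t ↦ (hW.aemeasurable _).sub ((hW.aemeasurable T).const_mul _)) hcov
  have hind' : IndepFun (W T) (fun ω n ↦ Z (TopologicalSpace.denseSeq _ n) ω : Ω → ℕ → ℝ) P :=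
    hind.comp (φ := fun x : Unit → ℝ ↦ x ())
      (ψ := fun (x : Set.Icc (0 : ℝ≥0) T → ℝ) n ↦ x (TopologicalSpace.denseSeq _ n))
      (measurable_pi_apply _) (measurable_pi_lambda _ fun _ ↦ measurable_pi_apply _)
  have hsamp : (fun ω n ↦ Z (TopologicalSpace.denseSeq _ n) ω : Ω → ℕ → ℝ)
      =ᵐ[P] fun ω ↦ sampledPath (standardBridge T W ω) := by
    refine EventuallyEq.symm ((sampledPath_toPath_ae_eq ?_).trans (ae_of_all _ fun ω ↦ ?_))
    · filter_upwards [hW.cont] with ω hω using continuous_standardBridge_fun hω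
    · funext n
      simp only [Z]
      ring
  have := (hind'.congr EventuallyEq.rfl hsamp).comp measurable_id
    (measurableEmbedding_sampledPath (T := T)).measurable_invFun
  refine this.congr EventuallyEq.rfl (ae_of_all _ fun ω ↦ ?_)
  exact measurableEmbedding_sampledPath.leftInverse_invFun _

lemma aemeasurable_bridge (hB : IsBrownianReal B P') (σ a b : ℝ) :
    AEMeasurable (bridge T B σ a b) P' := by
  have hF : Measurable fun z : PathSpace T ↦ bridgeOf T σ a (b, z) :=
    (continuous_bridgeOf T σ a).measurable.comp measurable_prodMk_left
  exact (hF.comp_aemeasurable (aemeasurable_standardBridge hB)).congr (bridge_ae_eq hB σ a b).symm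

lemma endpoint_driftedBM_mem_support (hW : IsBrownianReal W P) (hT : 0 < T) {σ : ℝ} (hσ : σ ≠ 0)
    (c a b : ℝ) {U : Set ℝ} (hU : U ∈ 𝓝 b) :
    P ((fun ω ↦ endpoint (driftedBM T W σ c a ω)) ⁻¹' U) ≠ 0 := by
  intro h0
  have hV : Continuous fun x : ℝ ↦ a + c * (T : ℝ) + σ * x := by fun_prop
  obtain ⟨V, hVU, hVo, hbV⟩ := mem_nhds_iff.1 hU
  have hO := hVo.preimage hV
  have hne : ((fun x : ℝ ↦ a + c * (T : ℝ) + σ * x) ⁻¹' V).Nonempty :=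
    ⟨(b - (a + c * (T : ℝ))) / σ, by simpa [mul_div_cancel₀ _ hσ] using hbV⟩
  have hnull : P (W T ⁻¹' ((fun x : ℝ ↦ a + c * (T : ℝ) + σ * x) ⁻¹' V)) = 0 := by
    have hae : (fun ω ↦ endpoint (driftedBM T W σ c a ω)) ⁻¹' V
        =ᵐ[P] W T ⁻¹' ((fun x : ℝ ↦ a + c * (T : ℝ) + σ * x) ⁻¹' V) := by
      filter_upwards [endpoint_driftedBM_ae_eq hW σ c a] with ω hω
      exact congrArg (· ∈ V) hω
    rw [← measure_congr hae]
    exact measure_mono_null (Set.preimage_mono hVU) h0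
  rw [← Measure.map_apply_of_aemeasurable (hW.aemeasurable T) hO.measurableSet,
    (hW.hasLaw_eval T).map_eq] at hnull
  exact hO.measure_ne_zero volume hne (gaussianReal_absolutelyContinuous' 0 hT.ne' hnull)

end Bridge

section Main

variable {Ω Ω' : Type*} [MeasurableSpace Ω] [MeasurableSpace Ω'] {P : Measure Ω} {P' : Measure Ω'}
  [IsProbabilityMeasure P] [IsProbabilityMeasure P']
  {T : ℝ≥0} {W : ℝ≥0 → Ω → ℝ} {B : ℝ≥0 → Ω' → ℝ}

/-- The Markov kernel of the bridges from `a`, with the end value as parameter. -/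
def bridgeKernel (T : ℝ≥0) (B : ℝ≥0 → Ω → ℝ) (P : Measure Ω) [IsProbabilityMeasure P] (σ a : ℝ) :
    Kernel ℝ (PathSpace T) :=
  freezeKernel (P.map (standardBridge T B)) (bridgeOf T σ a) (continuous_bridgeOf T σ a).measurable

lemma isMarkovKernel_bridgeKernel (hB : IsBrownianReal B P') (σ a : ℝ) :
    IsMarkovKernel (bridgeKernel T B P' σ a) := by
  have : IsProbabilityMeasure (P'.map (standardBridge T B)) :=
    Measure.isProbabilityMeasure_map (aemeasurable_standardBridge hB)
  unfold bridgeKernel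
  infer_instance

lemma bridgeKernel_apply (hB : IsBrownianReal B P') (σ a b : ℝ) :
    bridgeKernel T B P' σ a b = P'.map (bridge T B σ a b) := by
  have hF : Measurable fun z : PathSpace T ↦ bridgeOf T σ a (b, z) :=
    (continuous_bridgeOf T σ a).measurable.comp measurable_prodMk_left
  rw [Measure.map_congr (bridge_ae_eq hB σ a b), bridgeKernel, freezeKernel_apply,
    AEMeasurable.map_map_of_aemeasurable hF.aemeasurable (aemeasurable_standardBridge hB)]
  rfl

lemma continuous_integral_bridgeKernel (hB : IsBrownianReal B P') (σ a : ℝ)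
    (f : PathSpace T →ᵇ ℝ) : Continuous fun b ↦ ∫ x, f x ∂(bridgeKernel T B P' σ a b) := by
  have hF (b : ℝ) : Continuous fun z : PathSpace T ↦ bridgeOf T σ a (b, z) :=
    (continuous_bridgeOf T σ a).comp (Continuous.prodMk_right b)
  have : IsProbabilityMeasure (P'.map (standardBridge T B)) :=
    Measure.isProbabilityMeasure_map (aemeasurable_standardBridge hB)
  have heq (b : ℝ) : ∫ x, f x ∂(bridgeKernel T B P' σ a b)
      = ∫ z, f (bridgeOf T σ a (b, z)) ∂(P'.map (standardBridge T B)) := by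
    rw [bridgeKernel, freezeKernel_apply, integral_map (hF b).measurable.aemeasurable
      f.continuous.measurable.aestronglyMeasurable]
  simp_rw [heq]
  refine continuous_of_dominated (bound := fun _ ↦ ‖f‖)
    (fun b ↦ (f.continuous.comp (hF b)).measurable.aestronglyMeasurable)
    (fun b ↦ ae_of_all _ fun z ↦ f.norm_coe_le_norm _) (integrable_const _)
    (ae_of_all _ fun z ↦ ?_)
  exact f.continuous.comp ((continuous_bridgeOf T σ a).comp (Continuous.prodMk_left z))

/-- The law of the drifted motion given its terminal value is that of the driftless bridge. -/
lemma hasCondDistrib_driftedBM (hW : IsBrownianReal W P) (hB : IsBrownianReal B P') (hT : 0 < T)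
    (σ c a : ℝ) :
    HasCondDistrib (driftedBM T W σ c a) (fun ω ↦ endpoint (driftedBM T W σ c a ω))
      (bridgeKernel T B P' σ a) P := by
  have hV : Measurable fun x : ℝ ↦ a + c * (T : ℝ) + σ * x := by fun_prop
  have hind : IndepFun (fun ω ↦ a + c * (T : ℝ) + σ * W T ω) (standardBridge T W) P :=
    (indepFun_standardBridge hW hT).comp hV measurable_id
  have : IsProbabilityMeasure (P'.map (standardBridge T B)) :=
    Measure.isProbabilityMeasure_map (aemeasurable_standardBridge hB)
  exact hasCondDistrib_congr (IndepFun.hasCondDistrib_freezeKernel hind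
    (hV.comp_aemeasurable (hW.aemeasurable T))
    ⟨aemeasurable_standardBridge hW, map_standardBridge_eq hW hB⟩ _)
    (driftedBM_ae_eq hW hT σ c a) (endpoint_driftedBM_ae_eq hW σ c a)

lemma hasCondLawAt_driftedBM (hW : IsBrownianReal W P) (hB : IsBrownianReal B P') (hT : 0 < T)
    {σ : ℝ} (hσ : σ ≠ 0) (c a b : ℝ) :
    HasCondLawAt (driftedBM T W σ c a) (fun ω ↦ endpoint (driftedBM T W σ c a ω)) P b
      (P'.map (bridge T B σ a b)) := by
  have := isMarkovKernel_bridgeKernel (T := T) hB σ a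
  rw [← bridgeKernel_apply hB]
  exact .of_hasCondDistrib (hasCondDistrib_driftedBM hW hB hT σ c a)
    (fun U hU ↦ endpoint_driftedBM_mem_support hW hT hσ c a b hU)
    fun f ↦ (continuous_integral_bridgeKernel hB σ a f).continuousAt

lemma hasCondDistrib_bridge_pathMax_iff (hB : IsBrownianReal B P') (σ a b : ℝ)
    (η : Kernel (ℝ × ℝ) (PathSpace T)) [IsMarkovKernel η] :
    HasCondDistrib (bridge T B σ a b) (fun ω ↦ pathMax (bridge T B σ a b ω)) (η.sectR b) P' ↔
      ((bridgeKernel T B P' σ a).map pathMax ⊗ₖ η) b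
        = (bridgeKernel T B P' σ a).map (fun x ↦ (pathMax x, x)) b := by
  have := isMarkovKernel_bridgeKernel (T := T) hB σ a
  have hY := aemeasurable_bridge (T := T) hB σ a b
  have hm : Measurable (pathMax : PathSpace T → ℝ) := continuous_pathMax.measurable
  have hmp : Measurable fun x : PathSpace T ↦ (pathMax x, x) := hm.prodMk measurable_id
  rw [Kernel.compProd_apply_eq_compProd_sectR, Kernel.map_apply _ hm, Kernel.map_apply _ hmp,
    bridgeKernel_apply hB, AEMeasurable.map_map_of_aemeasurable hm.aemeasurable hY,
    AEMeasurable.map_map_of_aemeasurable hmp.aemeasurable hY]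
  exact ⟨fun h ↦ h.map_eq.symm, fun h ↦ ⟨hmp.comp_aemeasurable hY, h.symm⟩⟩

lemma exists_isBridgeGivenMax (hB : IsBrownianReal B P') (σ a : ℝ) :
    ∃ η : Kernel (ℝ × ℝ) (PathSpace T), IsBridgeGivenMax T B P' σ a η := by
  have := isMarkovKernel_bridgeKernel (T := T) hB σ a
  have hm : Measurable (pathMax : PathSpace T → ℝ) := continuous_pathMax.measurable
  set κ := (bridgeKernel T B P' σ a).map fun x ↦ (pathMax x, x) with hκ
  have : IsMarkovKernel κ := Kernel.IsMarkovKernel.map _ (hm.prodMk measurable_id)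
  refine ⟨κ.condKernel, inferInstance, fun b ↦ ?_⟩
  rw [hasCondDistrib_bridge_pathMax_iff hB, ← hκ]
  have hfst : (bridgeKernel T B P' σ a).map pathMax = κ.fst := by
    rw [hκ, Kernel.fst_map_prod _ (g := fun x ↦ x) measurable_id]
  rw [hfst, κ.disintegrate]

/-- The law of the drifted motion given its terminal value and its maximum. -/
lemma IsBridgeGivenMax.hasCondDistrib_driftedBM (hW : IsBrownianReal W P)
    (hB : IsBrownianReal B P') (hT : 0 < T) {σ a : ℝ} {η : Kernel (ℝ × ℝ) (PathSpace T)}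
    (hη : IsBridgeGivenMax T B P' σ a η) (c : ℝ) :
    HasCondDistrib (driftedBM T W σ c a) (fun ω ↦ (endpoint (driftedBM T W σ c a ω),
      pathMax (driftedBM T W σ c a ω))) η P := by
  have := isMarkovKernel_bridgeKernel (T := T) hB σ a
  have := hη.1
  have hm : Measurable (pathMax : PathSpace T → ℝ) := continuous_pathMax.measurable
  have : IsMarkovKernel ((bridgeKernel T B P' σ a).map pathMax) := Kernel.IsMarkovKernel.map _ hm
  refine HasCondDistrib.of_compProd (κ := (bridgeKernel T B P' σ a).map pathMax) ?_
  have heq : (bridgeKernel T B P' σ a).map pathMax ⊗ₖ η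
      = (bridgeKernel T B P' σ a).map fun x ↦ (pathMax x, x) :=
    Kernel.ext fun b ↦ (hasCondDistrib_bridge_pathMax_iff hB σ a b η).1 (hη.2 b)
  rw [heq]
  exact (DriftBridge.hasCondDistrib_driftedBM hW hB hT σ c a).comp_left (hm.prodMk measurable_id)

lemma hasCondLawAt_geometricBM (hW : IsBrownianReal W P) (hB : IsBrownianReal B P') (hT : 0 < T)
    {σ : ℝ} (hσ : σ ≠ 0) (c : ℝ) {a b : ℝ} (ha : 0 < a) (hb : 0 < b) :
    HasCondLawAt (geometricBM T W σ c a) (fun ω ↦ endpoint (geometricBM T W σ c a ω)) P b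
      (P'.map fun ω ↦ expPath (bridge T B σ (Real.log a) (Real.log b) ω)) := by
  have h := (hasCondLawAt_driftedBM hW hB hT hσ c (Real.log a) (Real.log b)).map continuous_expPath
    Real.isOpenEmbedding_exp.isEmbedding
  rw [Real.exp_log hb, AEMeasurable.map_map_of_aemeasurable
    continuous_expPath.measurable.aemeasurable (aemeasurable_bridge hB _ _ _)] at h
  refine h.congr (geometricBM_ae_eq hW σ c ha) ?_
  filter_upwards [geometricBM_ae_eq (T := T) hW σ c ha] with ω hω
  rw [hω, endpoint_expPath]

/-- Conditional distributions of the exponential of a path, when the conditioning variable is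
transformed by a map with a measurable left inverse. -/
lemma HasCondDistrib.expPath_comp {ι : Type*} [MeasurableSpace ι] {X : Ω → PathSpace T} {Y : Ω → ι}
    {κ : Kernel ι (PathSpace T)} [IsMarkovKernel κ] (h : HasCondDistrib X Y κ P) {e l : ι → ι}
    (he : Measurable e) (hl : Measurable l) (hle : ∀ y, l (e y) = y) :
    HasCondDistrib (fun ω ↦ expPath (X ω)) (fun ω ↦ e (Y ω)) ((κ.comap l hl).map expPath) P := by
  have hm : Measurable (expPath : PathSpace T → PathSpace T) := continuous_expPath.measurable
  have : IsMarkovKernel ((κ.comap l hl).map expPath) := Kernel.IsMarkovKernel.map _ hm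
  refine HasCondDistrib.comp_right (f := e) (hf := he) (Z := Y) ?_
  have heq : ((κ.comap l hl).map expPath).comap e he = κ.map expPath := by
    ext1 y
    rw [Kernel.comap_apply, Kernel.map_apply _ hm, Kernel.map_apply _ hm, Kernel.comap_apply, hle]
  rw [heq]
  exact h.comp_left hm

lemma hasCondDistrib_geometricBM (hW : IsBrownianReal W P) (hB : IsBrownianReal B P')
    (hT : 0 < T) (σ c : ℝ) {a : ℝ} (ha : 0 < a) :
    HasCondDistrib (geometricBM T W σ c a) (fun ω ↦ endpoint (geometricBM T W σ c a ω))
      (((bridgeKernel T B P' σ (Real.log a)).comap Real.log Real.measurable_log).map expPath) P := by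
  have := isMarkovKernel_bridgeKernel (T := T) hB σ (Real.log a)
  have hae := geometricBM_ae_eq (T := T) hW σ c ha
  refine hasCondDistrib_congr (HasCondDistrib.expPath_comp
    (hasCondDistrib_driftedBM hW hB hT σ c (Real.log a)) Real.measurable_exp Real.measurable_log
    Real.log_exp) hae ?_
  filter_upwards [hae] with ω hω
  rw [hω, endpoint_expPath]

lemma IsBridgeGivenMax.hasCondDistrib_geometricBM (hW : IsBrownianReal W P)
    (hB : IsBrownianReal B P') (hT : 0 < T) {σ a : ℝ} (ha : 0 < a)
    {η : Kernel (ℝ × ℝ) (PathSpace T)} (hη : IsBridgeGivenMax T B P' σ (Real.log a) η) (c : ℝ) :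
    HasCondDistrib (geometricBM T W σ c a) (fun ω ↦ (endpoint (geometricBM T W σ c a ω),
        pathMax (geometricBM T W σ c a ω)))
      ((η.comap (fun p : ℝ × ℝ ↦ (Real.log p.1, Real.log p.2)) (by fun_prop)).map expPath) P := by
  have := hη.1
  have hae := geometricBM_ae_eq (T := T) hW σ c ha
  refine hasCondDistrib_congr (HasCondDistrib.expPath_comp (hη.hasCondDistrib_driftedBM hW hB hT c)
    (e := fun p : ℝ × ℝ ↦ (Real.exp p.1, Real.exp p.2)) (by fun_prop) (by fun_prop)
    fun p ↦ by simp) hae ?_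
  filter_upwards [hae] with ω hω
  rw [hω, endpoint_expPath, pathMax_expPath]

end Main

end DriftBridge

end

theorem mainTheorem2
    {Ω Ω' : Type*} [MeasurableSpace Ω] [MeasurableSpace Ω']
    (P : Measure Ω) [IsProbabilityMeasure P] (P' : Measure Ω') [IsProbabilityMeasure P']
    (W : ℝ≥0 → Ω → ℝ) (hW : IsBrownianReal W P)
    (B : ℝ≥0 → Ω' → ℝ) (hB : IsBrownianReal B P')
    (T : ℝ≥0) (hT : 0 < T) (σ : ℝ) (hσ : 0 < σ) :
    -- regular conditional law of the drifted motion given its endpoint, the same for all drifts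
    (∀ a : ℝ, ∃ κ : Kernel ℝ (DriftBridge.PathSpace T), IsMarkovKernel κ ∧
      (∀ b : ℝ, κ b = P'.map (DriftBridge.bridge T B σ a b)) ∧
      ∀ c : ℝ, HasCondDistrib (DriftBridge.driftedBM T W σ c a)
        (fun ω ↦ DriftBridge.endpoint (DriftBridge.driftedBM T W σ c a ω)) κ P) ∧
    -- the same at every single endpoint `b`
    (∀ a b c : ℝ, DriftBridge.HasCondLawAt (DriftBridge.driftedBM T W σ c a)
      (fun ω ↦ DriftBridge.endpoint (DriftBridge.driftedBM T W σ c a ω)) P b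
      (P'.map (DriftBridge.bridge T B σ a b))) ∧
    -- conditioning on the endpoint and the maximum
    (∀ a : ℝ, (∃ η : Kernel (ℝ × ℝ) (DriftBridge.PathSpace T),
        DriftBridge.IsBridgeGivenMax T B P' σ a η) ∧
      ∀ η : Kernel (ℝ × ℝ) (DriftBridge.PathSpace T), DriftBridge.IsBridgeGivenMax T B P' σ a η →
        ∀ c : ℝ, HasCondDistrib (DriftBridge.driftedBM T W σ c a)
          (fun ω ↦ (DriftBridge.endpoint (DriftBridge.driftedBM T W σ c a ω),
            DriftBridge.pathMax (DriftBridge.driftedBM T W σ c a ω))) η P) ∧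
    -- the same at every single endpoint `b` and maximum `M`; `μ` is the drifted bridge
    (∀ (a b c M : ℝ) (μ ν : Measure (DriftBridge.PathSpace T)),
      DriftBridge.HasCondLawAt (DriftBridge.driftedBM T W σ c a)
        (fun ω ↦ DriftBridge.endpoint (DriftBridge.driftedBM T W σ c a ω)) P b μ →
      (DriftBridge.HasCondLawAt id DriftBridge.pathMax μ M ν ↔
        DriftBridge.HasCondLawAt (DriftBridge.bridge T B σ a b)
          (fun ω ↦ DriftBridge.pathMax (DriftBridge.bridge T B σ a b ω)) P' M ν)) ∧
    -- geometric case, given the endpoint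
    (∀ a : ℝ, 0 < a → ∃ κ : Kernel ℝ (DriftBridge.PathSpace T), IsMarkovKernel κ ∧
      (∀ b : ℝ, 0 < b → κ b = P'.map
        (fun ω ↦ DriftBridge.expPath (DriftBridge.bridge T B σ (Real.log a) (Real.log b) ω))) ∧
      ∀ c : ℝ, HasCondDistrib (DriftBridge.geometricBM T W σ c a)
        (fun ω ↦ DriftBridge.endpoint (DriftBridge.geometricBM T W σ c a ω)) κ P) ∧
    (∀ a b c : ℝ, 0 < a → 0 < b → DriftBridge.HasCondLawAt (DriftBridge.geometricBM T W σ c a)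
      (fun ω ↦ DriftBridge.endpoint (DriftBridge.geometricBM T W σ c a ω)) P b
      (P'.map
        (fun ω ↦ DriftBridge.expPath (DriftBridge.bridge T B σ (Real.log a) (Real.log b) ω)))) ∧
    -- geometric case, given the endpoint and the maximum
    (∀ a : ℝ, 0 < a → ∀ η : Kernel (ℝ × ℝ) (DriftBridge.PathSpace T),
      DriftBridge.IsBridgeGivenMax T B P' σ (Real.log a) η →
      ∀ c : ℝ, HasCondDistrib (DriftBridge.geometricBM T W σ c a)
        (fun ω ↦ (DriftBridge.endpoint (DriftBridge.geometricBM T W σ c a ω),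
          DriftBridge.pathMax (DriftBridge.geometricBM T W σ c a ω)))
        ((η.comap (fun p : ℝ × ℝ ↦ (Real.log p.1, Real.log p.2)) (by fun_prop)).map
          DriftBridge.expPath) P) ∧
    (∀ (a b c M : ℝ) (μ ν : Measure (DriftBridge.PathSpace T)), 0 < a → 0 < b → 0 < M →
      DriftBridge.HasCondLawAt (DriftBridge.geometricBM T W σ c a)
        (fun ω ↦ DriftBridge.endpoint (DriftBridge.geometricBM T W σ c a ω)) P b μ →
      DriftBridge.HasCondLawAt (DriftBridge.bridge T B σ (Real.log a) (Real.log b))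
        (fun ω ↦ DriftBridge.pathMax
          (DriftBridge.bridge T B σ (Real.log a) (Real.log b) ω)) P' (Real.log M) ν →
      DriftBridge.HasCondLawAt id DriftBridge.pathMax μ M (ν.map DriftBridge.expPath)) := by
  have hσ' : σ ≠ 0 := hσ.ne'
  refine ⟨fun a ↦ ⟨DriftBridge.bridgeKernel T B P' σ a,
      DriftBridge.isMarkovKernel_bridgeKernel hB σ a, DriftBridge.bridgeKernel_apply hB σ a,
      fun c ↦ DriftBridge.hasCondDistrib_driftedBM hW hB hT σ c a⟩,
    fun a b c ↦ DriftBridge.hasCondLawAt_driftedBM hW hB hT hσ' c a b,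
    fun a ↦ ⟨DriftBridge.exists_isBridgeGivenMax hB σ a,
      fun η hη c ↦ hη.hasCondDistrib_driftedBM hW hB hT c⟩,
    fun a b c M μ ν hμ ↦ ?_, fun a ha ↦ ?_,
    fun a b c ha hb ↦ DriftBridge.hasCondLawAt_geometricBM hW hB hT hσ' c ha hb,
    fun a ha η hη c ↦ ?_, fun a b c M μ ν ha hb hM hμ hν ↦ ?_⟩
  · rw [hμ.unique (DriftBridge.hasCondLawAt_driftedBM hW hB hT hσ' c a b)]
    exact DriftBridge.hasCondLawAt_id_map_iff (DriftBridge.aemeasurable_bridge hB σ a b)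
      DriftBridge.continuous_pathMax.measurable
  · have := DriftBridge.isMarkovKernel_bridgeKernel (T := T) hB σ (Real.log a)
    have he : Measurable (DriftBridge.expPath : DriftBridge.PathSpace T → _) :=
      DriftBridge.continuous_expPath.measurable
    let κ := ((DriftBridge.bridgeKernel T B P' σ (Real.log a)).comap Real.log
      Real.measurable_log).map DriftBridge.expPath
    have : IsMarkovKernel κ := Kernel.IsMarkovKernel.map _ he
    refine ⟨κ, this, fun b _ ↦ ?_, fun c ↦ DriftBridge.hasCondDistrib_geometricBM hW hB hT σ c ha⟩
    rw [Kernel.map_apply _ he, Kernel.comap_apply, DriftBridge.bridgeKernel_apply hB,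
      AEMeasurable.map_map_of_aemeasurable he.aemeasurable
      (DriftBridge.aemeasurable_bridge hB _ _ _)]
    rfl
  · exact hη.hasCondDistrib_geometricBM hW hB hT ha c
  · have hX : AEMeasurable (fun ω ↦
        DriftBridge.expPath (DriftBridge.bridge T B σ (Real.log a) (Real.log b) ω)) P' :=
      DriftBridge.continuous_expPath.measurable.comp_aemeasurable
        (DriftBridge.aemeasurable_bridge hB _ _ _)
    rw [hμ.unique (DriftBridge.hasCondLawAt_geometricBM hW hB hT hσ' c ha hb),
      DriftBridge.hasCondLawAt_id_map_iff hX DriftBridge.continuous_pathMax.measurable]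
    simp_rw [DriftBridge.pathMax_expPath]
    have h := hν.map DriftBridge.continuous_expPath Real.isOpenEmbedding_exp.isEmbedding
    rwa [Real.exp_log hM] at h
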